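/- Let $\phi:\mathbb{R}^{n\times n}\to\mathbb{R}$ be twice differentiable, and let $\mu,L_1>0$. Suppose that $\phi$ is $L_1$-gradient Lipschitz, i.e. $\|\nabla\phi(M+E)-\nabla\phi(M)\|_F\le L_1\|E\|_F$ for all $M,E\in\mathbb{R}^{n\times n}$, and $(\mu,2r)$-restricted strongly convex, i.e. $\langle\nabla^2\phi(M)[E],E\rangle\ge\mu\|E\|_F^2$ for all $M,E\in\mathbb{R}^{n\times n}$ of rank at most $2r$. Let $M^\star$ be a global minimizer of $\phi$ over $\mathbb{R}^{n\times n}$ of the form $M^\star=X^\star X^{\star T}$ with $X^\star\in\mathbb{R}^{n\times r}$, and let $r^\star=\operatorname{rank}(M^\star)\le r$. Let $\lambda_{r^\star}(M^\star)$ be the $r^\star$-th largest eigenvalue of $M^\star$ (read as $0$ if $r^\star=0$). Define $f(X)=\phi(XX^T)$ for $X\in\mathbb{R}^{n\times r}$. If $X\in\mathbb{R}^{n\times r}$ satisfies $$f(X)-f(X^\star)\le\frac{\mu}{2(1+L_1/\mu)}\,\lambda_{r^\star}(M^\star)^2,$$ then $$\frac{\mu}{\sqrt2}\,\|XX^T-M^\star\|_F\le\|\nabla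 f(X)(X^TX)^{-1/2}\|_F\le 2L_1\,\|XX^T-M^\star\|_F ,$$ where, if $X^TX$ is singular, $(X^TX)^{-1/2}$ denotes the Moore–Penrose inverse of $(X^TX)^{1/2}$. Consequently $\eta=\|\nabla f(X)(X^TX)^{-1/2}\|_F\ge 0$ satisfies, with the positive constants $C_{\mathrm{lb}}=\mu/\sqrt2$ and $C_{\mathrm{ub}}=2L_1$, the condition $C_{\mathrm{lb}}\|XX^T-M^\star\|_F\le\eta\le C_{\mathrm{ub}}\|XX^T-M^\star\|_F$ on the regularization parameter of preconditioned gradient descent $X_+=X-\alpha\nabla f(X)(X^TX+\eta I)^{-1}$ that is required in the linear convergence theorem. -/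

import Mathlib

open Matrix

/-- The inverse square root `A^{-1/2}` of a symmetric positive semidefinite matrix `A`, by the
functional calculus: each eigenvalue `x > 0` is replaced by `1 / √x`.  As `(√0)⁻¹ = 0`, for singular
`A` this is the Moore-Penrose inverse of the square root of `A`; see `invSqrt_mul_self` and
`invSqrt_posSemidef` for the invertible case. -/
noncomputable def invSqrt {r : ℕ} (A : Matrix (Fin r) (Fin r) ℝ) : Matrix (Fin r) (Fin r) ℝ :=
  cfc (fun x : ℝ => (√x)⁻¹) A

theorem invSqrt_posSemidef {r : ℕ} (A : Matrix (Fin r) (Fin r) ℝ) : (invSqrt A).PosSemidef := by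
  open scoped MatrixOrder in
  exact Matrix.nonneg_iff_posSemidef.mp
    (cfc_nonneg (fun x _ => inv_nonneg.mpr (Real.sqrt_nonneg x)))

theorem invSqrt_mul_self {r : ℕ} {A : Matrix (Fin r) (Fin r) ℝ} (hA : A.PosDef) :
    invSqrt A * invSqrt A = A⁻¹ := by
  have hsa : IsSelfAdjoint A := hA.1
  have hfin : (spectrum ℝ A).Finite := Matrix.finite_real_spectrum
  have hc (f : ℝ → ℝ) : ContinuousOn f (spectrum ℝ A) := hfin.continuousOn f
  have hpos (x : ℝ) (hx : x ∈ spectrum ℝ A) : 0 < x := by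
    rw [hA.1.spectrum_real_eq_range_eigenvalues] at hx
    obtain ⟨i, rfl⟩ := hx
    exact hA.eigenvalues_pos i
  have h1 : invSqrt A * invSqrt A * A = 1 := by
    unfold invSqrt
    nth_rewrite 3 [← cfc_id' ℝ A hsa]
    rw [← cfc_mul _ _ A (hc _) (hc _), ← cfc_mul _ _ A (hc _) (hc _), ← cfc_one ℝ A hsa]
    refine cfc_congr fun x hx => ?_
    have h := hpos x hx
    have h2 : √x * √x = x := Real.mul_self_sqrt h.le
    have h3 : √x ≠ 0 := (Real.sqrt_pos.mpr h).ne'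
    change (√x)⁻¹ * (√x)⁻¹ * x = 1
    rw [← mul_inv, h2, inv_mul_cancel₀ h.ne']
  exact (Matrix.inv_eq_left_inv h1).symm

/-- `λ_i(A)`: the `i`-th eigenvalue (`1 ≤ i ≤ n`) of a symmetric matrix in descending order, with
multiplicity.  For other indices the value is `0`. -/
noncomputable def eigDesc {n : ℕ} (A : Matrix (Fin n) (Fin n) ℝ) (i : ℕ) : ℝ :=
  if h : A.IsHermitian ∧ 1 ≤ i ∧ i ≤ n then
    h.1.eigenvalues₀ ⟨i - 1, by rw [Fintype.card_fin]; omega⟩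
  else 0

-- From here on `‖A‖` is the Frobenius norm of a real matrix `A`.
open scoped Matrix.Norms.Frobenius

/-- The trace inner product `⟨A, B⟩ = tr(Aᵀ B)`, which induces the Frobenius norm. -/
noncomputable def matInner {m k : ℕ} (A B : Matrix (Fin m) (Fin k) ℝ) : ℝ := (Aᵀ * B).trace

/-- The gradient `∇g(X)` of a function of a matrix, as the matrix of its partial derivatives. -/
noncomputable def matGrad {m k : ℕ} (g : Matrix (Fin m) (Fin k) ℝ → ℝ) (X : Matrix (Fin m) (Fin k) ℝ) :
    Matrix (Fin m) (Fin k) ℝ :=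
  Matrix.of fun i j => fderiv ℝ g X (Matrix.single i j 1)

/-- The gradient represents the derivative with respect to the trace inner product. -/
theorem matInner_matGrad {m k : ℕ} (g : Matrix (Fin m) (Fin k) ℝ → ℝ)
    (X V : Matrix (Fin m) (Fin k) ℝ) : matInner (matGrad g X) V = fderiv ℝ g X V := by
  conv_rhs => rw [Matrix.matrix_eq_sum_single V]
  simp only [map_sum, matInner, Matrix.trace, Matrix.diag, Matrix.mul_apply, Matrix.transpose_apply]
  rw [Finset.sum_comm]
  refine Finset.sum_congr rfl fun i _ => Finset.sum_congr rfl fun j _ => ?_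
  have h : Matrix.single i j (V i j) = V i j • Matrix.single i j (1 : ℝ) := by
    rw [Matrix.smul_single, smul_eq_mul, mul_one]
  rw [h, map_smul, smul_eq_mul, mul_comm]
  rfl

/-- The Hessian `∇²g(X)[V]`, the directional derivative of the gradient. -/
noncomputable def matHess {m k : ℕ} (g : Matrix (Fin m) (Fin k) ℝ → ℝ) (X V : Matrix (Fin m) (Fin k) ℝ) :
    Matrix (Fin m) (Fin k) ℝ :=
  fderiv ℝ (matGrad g) X V

/-- `φ` is differentiable and `L`-gradient Lipschitz in the Frobenius norm. -/
structure GradientLipschitz {n : ℕ} (φ : Matrix (Fin n) (Fin n) ℝ → ℝ) (L : ℝ) : Prop where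
  differentiable : Differentiable ℝ φ
  lipschitz : ∀ M E : Matrix (Fin n) (Fin n) ℝ,
    ‖matGrad φ (M + E) - matGrad φ M‖ ≤ L * ‖E‖

/-- `φ` is twice differentiable and `(μ, k)`-restricted strongly convex. -/
structure RestrictedStronglyConvex {n : ℕ} (φ : Matrix (Fin n) (Fin n) ℝ → ℝ) (μ : ℝ) (k : ℕ) :
    Prop where
  differentiable : Differentiable ℝ φ
  differentiable_grad : Differentiable ℝ (matGrad φ)
  strong : ∀ M E : Matrix (Fin n) (Fin n) ℝ, M.rank ≤ k → E.rank ≤ k →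
    μ * ‖E‖ ^ 2 ≤ matInner (matHess φ M E) E

/-- The factored objective `f(X) = φ(X Xᵀ)` over `n × r` matrices. -/
noncomputable def factored {n : ℕ} (r : ℕ) (φ : Matrix (Fin n) (Fin n) ℝ → ℝ) (X : Matrix (Fin n) (Fin r) ℝ) :
    ℝ :=
  φ (X * Xᵀ)

/-- The parameter `η = ‖∇f(X) (Xᵀ X)^{-1/2}‖_F`. -/
noncomputable def optimalEta {n r : ℕ} (φ : Matrix (Fin n) (Fin n) ℝ → ℝ) (X : Matrix (Fin n) (Fin r) ℝ) : ℝ :=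
  ‖matGrad (factored r φ) X * invSqrt (Xᵀ * X)‖

/-- The condition on the regularization parameter `η ≥ 0` of preconditioned gradient descent
`X₊ = X - α ∇f(X) (Xᵀ X + η I)⁻¹` in the linear convergence theorem: `η` is within the constant
factors `Clb, Cub > 0` of the error norm. -/
structure AdmissibleEta {n r : ℕ} (Mstar : Matrix (Fin n) (Fin n) ℝ) (X : Matrix (Fin n) (Fin r) ℝ)
    (Clb Cub η : ℝ) : Prop where
  lb_pos : 0 < Clb
  ub_pos : 0 < Cub
  nonneg : 0 ≤ η
  lower : Clb * ‖X * Xᵀ - Mstar‖ ≤ η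
  upper : η ≤ Cub * ‖X * Xᵀ - Mstar‖

/-! Write `E = XXᵀ - M⋆`, `G = ∇φ(XXᵀ)`, `P` for the orthogonal projection onto the columns of `X`,
and `Q = 1 - P`. Since `∇f(X) = (G + Gᵀ)X`, the quantity to bound is `‖(G + Gᵀ)P‖`
(`norm_mul_mul_invSqrt`). The upper bound drops `P` and uses `∇φ(M⋆) = 0` with the Lipschitz
condition.

For the lower bound, test against `Z = EP - PEP/2`: the pairing is `⟨G, D⟩` with `D = Z + Zᵀ = E -
QEQ`. Along the segment from `M⋆` to `XXᵀ`, polarization of the Hessian (`matHess_bilinear_lower`)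
gives `2⟨G, D⟩ ≥ (μ + L)‖D‖² - (L - μ)‖E‖‖D‖`. If `(μ + L)‖D‖ ≥ L‖E‖`, this is at least `μ‖E‖‖D‖`,
and `√2‖Z‖ ≤ ‖D‖` turns it into the constant `μ/√2`.

The condition on `D` says that the normal part `QEQ` is small. As `QE = -QM⋆`, the spectral gap
gives `λ‖QEQ‖ ≤ ‖E‖²` (`norm_normal_mul_eigDesc_le`), while quadratic growth and the hypothesis on
`f` bound `‖E‖` by a multiple of `λ` (`tangent_bound`). -/

/-! ### The trace inner product -/

section Inner
variable {m k l : ℕ}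

theorem matInner_eq_sum (A B : Matrix (Fin m) (Fin k) ℝ) :
    matInner A B = ∑ i, ∑ j, A i j * B i j := by
  simp only [matInner, Matrix.trace, Matrix.diag, Matrix.mul_apply, Matrix.transpose_apply]
  exact Finset.sum_comm

theorem matInner_comm (A B : Matrix (Fin m) (Fin k) ℝ) : matInner A B = matInner B A := by
  simp only [matInner_eq_sum, mul_comm]

theorem matInner_add_left (A B C : Matrix (Fin m) (Fin k) ℝ) :
    matInner (A + B) C = matInner A C + matInner B C := by
  simp [matInner, Matrix.add_mul]

theorem matInner_add_right (A B C : Matrix (Fin m) (Fin k) ℝ) :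
    matInner A (B + C) = matInner A B + matInner A C := by
  simp [matInner, Matrix.mul_add]

theorem matInner_sub_left (A B C : Matrix (Fin m) (Fin k) ℝ) :
    matInner (A - B) C = matInner A C - matInner B C := by
  simp [matInner, Matrix.sub_mul]

theorem matInner_sub_right (A B C : Matrix (Fin m) (Fin k) ℝ) :
    matInner A (B - C) = matInner A B - matInner A C := by
  simp [matInner, Matrix.mul_sub]

theorem matInner_smul_left (c : ℝ) (A B : Matrix (Fin m) (Fin k) ℝ) :
    matInner (c • A) B = c * matInner A B := by
  simp [matInner]

theorem matInner_smul_right (c : ℝ) (A B : Matrix (Fin m) (Fin k) ℝ) :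
    matInner A (c • B) = c * matInner A B := by
  simp [matInner]

theorem matInner_zero_left (A : Matrix (Fin m) (Fin k) ℝ) : matInner 0 A = 0 := by
  simp [matInner]

theorem matInner_transpose (A : Matrix (Fin m) (Fin k) ℝ) (B : Matrix (Fin k) (Fin m) ℝ) :
    matInner A Bᵀ = matInner Aᵀ B := by
  simp only [matInner_eq_sum, Matrix.transpose_apply]
  exact Finset.sum_comm

theorem matInner_mul_right (A : Matrix (Fin m) (Fin k) ℝ) (B : Matrix (Fin m) (Fin l) ℝ)
    (C : Matrix (Fin l) (Fin k) ℝ) : matInner A (B * C) = matInner (A * Cᵀ) B := by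
  rw [matInner, matInner, Matrix.transpose_mul, Matrix.transpose_transpose, ← Matrix.mul_assoc,
    Matrix.trace_mul_comm, Matrix.mul_assoc]

theorem matInner_self (A : Matrix (Fin m) (Fin k) ℝ) : matInner A A = ‖A‖ ^ 2 := by
  rw [matInner_eq_sum, Matrix.frobenius_norm_def, ← Real.sqrt_eq_rpow, Real.sq_sqrt (by positivity)]
  refine Finset.sum_congr rfl fun i _ => Finset.sum_congr rfl fun j _ => ?_
  rw [Real.norm_eq_abs, Real.rpow_two, sq_abs, sq]

theorem norm_add_sq_matInner (A B : Matrix (Fin m) (Fin k) ℝ) :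
    ‖A + B‖ ^ 2 = ‖A‖ ^ 2 + 2 * matInner A B + ‖B‖ ^ 2 := by
  rw [← matInner_self, matInner_add_left, matInner_add_right, matInner_add_right,
    matInner_comm B A, matInner_self, matInner_self]
  ring

theorem norm_sub_sq_matInner (A B : Matrix (Fin m) (Fin k) ℝ) :
    ‖A - B‖ ^ 2 = ‖A‖ ^ 2 - 2 * matInner A B + ‖B‖ ^ 2 := by
  rw [← matInner_self, matInner_sub_left, matInner_sub_right, matInner_sub_right,
    matInner_comm B A, matInner_self, matInner_self]
  ring

theorem abs_matInner_le (A B : Matrix (Fin m) (Fin k) ℝ) : |matInner A B| ≤ ‖A‖ * ‖B‖ := by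
  refine abs_le_of_sq_le_sq ?_ (by positivity)
  rw [mul_pow, ← matInner_self, ← matInner_self]
  simp only [matInner_eq_sum, ← Finset.sum_product', ← sq]
  exact Finset.sum_mul_sq_le_sq_mul_sq _ _ _

theorem matInner_le_norm_mul_norm (A B : Matrix (Fin m) (Fin k) ℝ) : matInner A B ≤ ‖A‖ * ‖B‖ :=
  (le_abs_self _).trans (abs_matInner_le A B)

theorem norm_transpose_frobenius (A : Matrix (Fin m) (Fin k) ℝ) : ‖Aᵀ‖ = ‖A‖ :=
  Matrix.frobenius_norm_transpose A

theorem eq_of_matInner_eq {A B : Matrix (Fin m) (Fin k) ℝ}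
    (h : ∀ V, matInner A V = matInner B V) : A = B := by
  have h1 : matInner (A - B) (A - B) = 0 := by rw [matInner_sub_left, h, sub_self]
  rw [matInner_self] at h1
  exact sub_eq_zero.mp (norm_eq_zero.mp (pow_eq_zero_iff two_ne_zero |>.mp h1))

theorem norm_mul_eq_of_mul_transpose_eq {p q : ℕ} (A : Matrix (Fin m) (Fin k) ℝ)
    (B : Matrix (Fin k) (Fin p) ℝ) (C : Matrix (Fin k) (Fin q) ℝ) (h : B * Bᵀ = C * Cᵀ) :
    ‖A * B‖ = ‖A * C‖ := by
  refine (sq_eq_sq₀ (norm_nonneg _) (norm_nonneg _)).mp ?_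
  rw [← matInner_self, ← matInner_self, matInner_mul_right, matInner_mul_right, Matrix.mul_assoc,
    Matrix.mul_assoc, h]

/-- Pythagoras for an orthogonal projection `P`. -/
theorem norm_sq_eq_add_of_projection {P : Matrix (Fin k) (Fin k) ℝ} (hPt : Pᵀ = P) (hP : P * P = P)
    (A : Matrix (Fin m) (Fin k) ℝ) : ‖A‖ ^ 2 = ‖A * P‖ ^ 2 + ‖A * (1 - P)‖ ^ 2 := by
  have h : matInner (A * P) (A * (1 - P)) = 0 := by
    rw [matInner_mul_right, Matrix.transpose_sub, hPt, Matrix.transpose_one, Matrix.mul_assoc,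
      Matrix.mul_sub, hP, Matrix.mul_one, sub_self, Matrix.mul_zero, matInner_zero_left]
  have h2 : A = A * P + A * (1 - P) := by
    rw [Matrix.mul_sub, Matrix.mul_one, add_sub_cancel]
  conv_lhs => rw [h2]
  rw [norm_add_sq_matInner, h]
  ring

theorem norm_mul_projection_le {P : Matrix (Fin k) (Fin k) ℝ} (hPt : Pᵀ = P) (hP : P * P = P)
    (A : Matrix (Fin m) (Fin k) ℝ) : ‖A * P‖ ≤ ‖A‖ := by
  refine (sq_le_sq₀ (norm_nonneg _) (norm_nonneg _)).mp ?_
  rw [norm_sq_eq_add_of_projection hPt hP A]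
  exact le_add_of_nonneg_right (sq_nonneg _)

end Inner

/-! ### The orthogonal projection onto the column space -/

/-- `X (Xᵀ X)⁺ Xᵀ`, the orthogonal projection onto the column space of `X`. -/
noncomputable def colProj {n r : ℕ} (X : Matrix (Fin n) (Fin r) ℝ) : Matrix (Fin n) (Fin n) ℝ :=
  (X * invSqrt (Xᵀ * X)) * (X * invSqrt (Xᵀ * X))ᵀ

section Proj
variable {n r : ℕ} (X : Matrix (Fin n) (Fin r) ℝ)

theorem invSqrt_transpose (A : Matrix (Fin r) (Fin r) ℝ) : (invSqrt A)ᵀ = invSqrt A := by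
  have h := (invSqrt_posSemidef A).1
  rwa [Matrix.IsHermitian, Matrix.conjTranspose_eq_transpose_of_trivial] at h

/-- On the spectrum this is `x * x⁻¹ * x = x`, true also at `x = 0`, so singular `Xᵀ X` needs no
separate case. -/
theorem mul_invSqrt_mul_self_mul {A : Matrix (Fin r) (Fin r) ℝ} (hA : A.PosSemidef) :
    A * (invSqrt A * invSqrt A) * A = A := by
  have hsa : IsSelfAdjoint A := hA.1
  have hfin : (spectrum ℝ A).Finite := Matrix.finite_real_spectrum
  have hc (f : ℝ → ℝ) : ContinuousOn f (spectrum ℝ A) := hfin.continuousOn f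
  have key : cfc (fun x : ℝ => x * ((√x)⁻¹ * (√x)⁻¹) * x) A = cfc (fun x : ℝ => x) A := by
    refine cfc_congr fun x hx => ?_
    rw [hA.1.spectrum_real_eq_range_eigenvalues] at hx
    obtain ⟨i, rfl⟩ := hx
    have h := hA.eigenvalues_nonneg i
    change _ * ((√_)⁻¹ * (√_)⁻¹) * _ = _
    rw [← mul_inv, Real.mul_self_sqrt h, mul_inv_mul_cancel]
  rw [cfc_mul _ _ A (hc _) (hc _), cfc_mul _ _ A (hc _) (hc _), cfc_mul _ _ A (hc _) (hc _),
    cfc_id' ℝ A hsa] at key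
  exact key

theorem colProj_eq : colProj X = X * (invSqrt (Xᵀ * X) * invSqrt (Xᵀ * X) * Xᵀ) := by
  rw [colProj, Matrix.transpose_mul, invSqrt_transpose]
  simp only [Matrix.mul_assoc]

theorem colProj_transpose : (colProj X)ᵀ = colProj X := by
  rw [colProj, Matrix.transpose_mul, Matrix.transpose_transpose]

/-- The residual `PX - X` is killed by `Xᵀ`, hence also by `P`, whose rightmost factor is `Xᵀ`; so
its Gram matrix vanishes. -/
theorem colProj_mul : colProj X * X = X := by
  have hA : (Xᵀ * X).PosSemidef := by
    have := Matrix.posSemidef_conjTranspose_mul_self X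
    rwa [Matrix.conjTranspose_eq_transpose_of_trivial] at this
  have h : Xᵀ * (colProj X * X - X) = 0 := by
    have := mul_invSqrt_mul_self_mul hA
    rw [Matrix.mul_sub, colProj_eq, sub_eq_zero]
    simpa only [Matrix.mul_assoc] using this
  have h2 : (colProj X * X - X)ᵀ * (colProj X * X - X) = 0 := by
    have h1 : colProj X * (colProj X * X - X) = 0 := by
      nth_rewrite 1 [colProj_eq]
      simp only [Matrix.mul_assoc, h, Matrix.mul_zero]
    rw [Matrix.transpose_sub, Matrix.sub_mul, h, Matrix.transpose_mul, colProj_transpose,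
      Matrix.mul_assoc, h1, Matrix.mul_zero, sub_zero]
  have h3 : matInner (colProj X * X - X) (colProj X * X - X) = 0 := by
    rw [matInner, h2, Matrix.trace_zero]
  rw [matInner_self] at h3
  exact sub_eq_zero.mp (norm_eq_zero.mp (pow_eq_zero_iff two_ne_zero |>.mp h3))

theorem colProj_mul_self : colProj X * colProj X = colProj X := by
  nth_rewrite 2 3 [colProj_eq]
  rw [← Matrix.mul_assoc, colProj_mul]

/-- `‖A B‖` depends on `B` only through `B Bᵀ`, which is `P` both for `X (Xᵀ X)^{-1/2}` and for `P`
itself. -/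
theorem norm_mul_mul_invSqrt (A : Matrix (Fin n) (Fin n) ℝ) :
    ‖A * X * invSqrt (Xᵀ * X)‖ = ‖A * colProj X‖ := by
  rw [Matrix.mul_assoc]
  refine norm_mul_eq_of_mul_transpose_eq _ _ _ ?_
  rw [colProj_transpose, colProj_mul_self, colProj]

end Proj

/-! ### The gap above zero in the spectrum of a positive semidefinite matrix -/

theorem Matrix.PosSemidef.eigenvalue_eq_zero_or_eigDesc_rank_le {n : ℕ}
    {M : Matrix (Fin n) (Fin n) ℝ} (hM : M.PosSemidef) (i : Fin n) :
    hM.1.eigenvalues i = 0 ∨ eigDesc M M.rank ≤ hM.1.eigenvalues i := by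
  by_cases h : M.IsHermitian ∧ 1 ≤ M.rank ∧ M.rank ≤ n
  swap
  -- In particular rank zero: the gap then takes the default value `0`.
  · rw [eigDesc, dif_neg h]
    exact Or.inr (hM.eigenvalues_nonneg i)
  rw [eigDesc, dif_pos h]
  let σ : Fin n ≃ Fin (Fintype.card (Fin n)) :=
    (Fintype.equivOfCardEq (Fintype.card_fin _)).symm
  have hσ (k : Fin n) : hM.1.eigenvalues k = hM.1.eigenvalues₀ (σ k) := rfl
  rw [hσ i]
  by_cases hj : (σ i : ℕ) ≤ M.rank - 1
  · exact Or.inr (hM.1.eigenvalues₀_antitone hj)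
  refine Or.inl (by_contra fun hne => ?_)
  have hpos : 0 < hM.1.eigenvalues₀ (σ i) :=
    lt_of_le_of_ne (hM.eigenvalues_nonneg i) (Ne.symm hne)
  have hcard : M.rank = Fintype.card {k // hM.1.eigenvalues₀ k ≠ 0} := by
    rw [hM.1.rank_eq_card_non_zero_eigs]
    exact Fintype.card_congr (σ.subtypeEquiv fun k => by rw [hσ k])
  -- Indices start at `0`: a positive eigenvalue at `σ i` forces `σ i + 1` nonzero ones, too many
  -- for the rank.
  have hle : (Finset.Iic (σ i)).card ≤ M.rank := by
    rw [hcard, Fintype.card_subtype]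
    refine Finset.card_le_card fun k hk => ?_
    rw [Finset.mem_filter]
    exact ⟨Finset.mem_univ _,
      (hpos.trans_le (hM.1.eigenvalues₀_antitone (Finset.mem_Iic.mp hk))).ne'⟩
  rw [Fin.card_Iic] at hle
  omega

theorem Matrix.PosSemidef.mul_self_sub_smul {n : ℕ} {M : Matrix (Fin n) (Fin n) ℝ}
    (hM : M.PosSemidef) : (M * M - eigDesc M M.rank • M).PosSemidef := by
  have hsa : IsSelfAdjoint M := hM.1
  have hfin : (spectrum ℝ M).Finite := Matrix.finite_real_spectrum
  have hc (f : ℝ → ℝ) : ContinuousOn f (spectrum ℝ M) := hfin.continuousOn f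
  have h : cfc (fun x : ℝ => x * x - eigDesc M M.rank * x) M = M * M - eigDesc M M.rank • M := by
    rw [cfc_sub _ _ M (hc _) (hc _), cfc_mul _ _ M (hc _) (hc _), cfc_const_mul _ _ M (hc _),
      cfc_id' ℝ M hsa]
  rw [← h]
  open scoped MatrixOrder in
  refine Matrix.nonneg_iff_posSemidef.mp (cfc_nonneg fun x hx => ?_)
  rw [hM.1.spectrum_real_eq_range_eigenvalues] at hx
  obtain ⟨i, rfl⟩ := hx
  have h0 := hM.eigenvalues_nonneg i
  rcases hM.eigenvalue_eq_zero_or_eigDesc_rank_le i with h1 | h1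
  · rw [h1]; simp
  · nlinarith

theorem posSemidef_mul_transpose_self {m k : ℕ} (Y : Matrix (Fin m) (Fin k) ℝ) :
    (Y * Yᵀ).PosSemidef := by
  have := Matrix.posSemidef_self_mul_conjTranspose Y
  rwa [Matrix.conjTranspose_eq_transpose_of_trivial] at this

theorem eigDesc_rank_nonneg {n : ℕ} {M : Matrix (Fin n) (Fin n) ℝ} (hM : M.PosSemidef) :
    0 ≤ eigDesc M M.rank := by
  rw [eigDesc]
  split_ifs with h
  · let σ : Fin n ≃ Fin (Fintype.card (Fin n)) :=
      (Fintype.equivOfCardEq (Fintype.card_fin _)).symm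
    have := hM.eigenvalues_nonneg (σ.symm ⟨M.rank - 1, by rw [Fintype.card_fin]; omega⟩)
    change 0 ≤ hM.1.eigenvalues₀ (σ (σ.symm _)) at this
    rwa [Equiv.apply_symm_apply] at this
  · exact le_rfl

theorem norm_mul_transpose_self_le_trace {m k : ℕ} (Y : Matrix (Fin m) (Fin k) ℝ) :
    ‖Y * Yᵀ‖ ≤ (Y * Yᵀ).trace := by
  calc ‖Y * Yᵀ‖ ≤ ‖Y‖ * ‖Yᵀ‖ := Matrix.frobenius_norm_mul _ _
    _ = ‖Y‖ ^ 2 := by rw [norm_transpose_frobenius, sq]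
    _ = (Y * Yᵀ).trace := by rw [← matInner_self, matInner, Matrix.trace_mul_comm]

/-- For symmetric `Q`, the part `Q Y Yᵀ Q` of `M = Y Yᵀ` is controlled by `Q M` through the smallest
nonzero eigenvalue of `M`. -/
theorem eigDesc_mul_norm_compression_le {n r : ℕ} (Y : Matrix (Fin n) (Fin r) ℝ)
    {Q : Matrix (Fin n) (Fin n) ℝ} (hQ : Qᵀ = Q) :
    eigDesc (Y * Yᵀ) (Y * Yᵀ).rank * ‖Q * (Y * Yᵀ) * Q‖ ≤ ‖Q * (Y * Yᵀ)‖ ^ 2 := by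
  set M := Y * Yᵀ with hMdef
  have hM : M.PosSemidef := posSemidef_mul_transpose_self Y
  have hMt : Mᵀ = M := by rw [hMdef, Matrix.transpose_mul, Matrix.transpose_transpose]
  have h1 : ‖Q * M * Q‖ ≤ (Q * M * Q).trace := by
    have := norm_mul_transpose_self_le_trace (Q * Y)
    rwa [Matrix.transpose_mul, hQ, show Q * Y * (Yᵀ * Q) = Q * M * Q by
      simp only [hMdef, Matrix.mul_assoc]] at this
  have h2 : ‖Q * M‖ ^ 2 = (Q * (M * M) * Q).trace := by
    rw [← norm_transpose_frobenius, ← matInner_self, matInner, Matrix.transpose_transpose,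
      Matrix.transpose_mul, hQ, hMt]
    simp only [Matrix.mul_assoc]
  -- The trace of `Q(M² - λM)Q` gives `λ tr(QMQ) ≤ ‖QM‖²`, and the trace dominates the norm by `h1`.
  have h3 := (hM.mul_self_sub_smul.mul_mul_conjTranspose_same Q).trace_nonneg
  rw [Matrix.conjTranspose_eq_transpose_of_trivial, hQ, Matrix.mul_sub, Matrix.sub_mul,
    Matrix.trace_sub, Matrix.mul_smul, Matrix.smul_mul, Matrix.trace_smul, ← h2, smul_eq_mul] at h3
  have h4 := mul_le_mul_of_nonneg_left h1 (eigDesc_rank_nonneg hM)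
  linarith

/-! ### Gradients and Hessians -/

section Calculus
variable {n r : ℕ}

theorem matGrad_factored {φ : Matrix (Fin n) (Fin n) ℝ → ℝ} (hφ : Differentiable ℝ φ)
    (X : Matrix (Fin n) (Fin r) ℝ) :
    matGrad (factored r φ) X
      = (matGrad φ (X * Xᵀ) + (matGrad φ (X * Xᵀ))ᵀ) * X := by
  have hb : IsBoundedBilinearMap ℝ
      (fun p : Matrix (Fin n) (Fin r) ℝ × Matrix (Fin n) (Fin r) ℝ => p.1 * p.2ᵀ) :=
    { add_left := fun a b c => Matrix.add_mul _ _ _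
      smul_left := fun c a b => Matrix.smul_mul _ _ _
      add_right := fun a b c => by simp [Matrix.mul_add]
      smul_right := fun c a b => by simp
      bound := ⟨1, one_pos, fun a b => by
        simpa [norm_transpose_frobenius] using Matrix.frobenius_norm_mul a bᵀ⟩ }
  have h1 : HasFDerivAt (fun Y : Matrix (Fin n) (Fin r) ℝ => Y * Yᵀ)
      ((hb.deriv (X, X)).comp ((ContinuousLinearMap.id ℝ _).prod (ContinuousLinearMap.id ℝ _))) X :=
    HasFDerivAt.comp (f := fun Y : Matrix (Fin n) (Fin r) ℝ => (Y, Y)) X (hb.hasFDerivAt (X, X))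
      ((hasFDerivAt_id X).prodMk (hasFDerivAt_id X))
  have h2 := (hφ (X * Xᵀ)).hasFDerivAt.comp X h1
  refine eq_of_matInner_eq fun V => ?_
  rw [matInner_matGrad, show fderiv ℝ (factored r φ) X = _ from h2.fderiv]
  change fderiv ℝ φ (X * Xᵀ) (X * Vᵀ + V * Xᵀ) = _
  set G := matGrad φ (X * Xᵀ) with hG
  rw [← matInner_matGrad, ← hG, Matrix.add_mul, matInner_add_right, matInner_add_left, add_comm,
    matInner_mul_right, Matrix.transpose_transpose]
  congr 1
  rw [← Matrix.transpose_transpose X, ← Matrix.transpose_mul, matInner_transpose,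
    matInner_mul_right]

/-- `B` plays the inner product identifying `g` with the derivative of `φ`. Symmetry of second
derivatives needs only differentiability of `g` at the point, not continuity of its derivative. -/
theorem fderiv_gradient_symm {E : Type*} [NormedAddCommGroup E] [NormedSpace ℝ E]
    (B : E →L[ℝ] E →L[ℝ] ℝ) {φ : E → ℝ} {g : E → E} (hφ : Differentiable ℝ φ)
    (hB : ∀ y v, B (g y) v = fderiv ℝ φ y v) {x : E} (hg : DifferentiableAt ℝ g x) (v w : E) :
    B (fderiv ℝ g x v) w = B (fderiv ℝ g x w) v := by
  refine second_derivative_symmetric (f := φ) (fun y => ?_) (B.hasFDerivAt.comp x hg.hasFDerivAt) v w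
  rw [Function.comp_apply, show B (g y) = fderiv ℝ φ y from ContinuousLinearMap.ext (hB y)]
  exact (hφ y).hasFDerivAt

theorem matHess_symm {φ : Matrix (Fin n) (Fin n) ℝ → ℝ} (hφ : Differentiable ℝ φ)
    (hg : Differentiable ℝ (matGrad φ)) (M V W : Matrix (Fin n) (Fin n) ℝ) :
    matInner (matHess φ M V) W = matInner (matHess φ M W) V := by
  exact fderiv_gradient_symm (LinearMap.mkContinuous₂ (LinearMap.mk₂ ℝ matInner matInner_add_left
    matInner_smul_left matInner_add_right matInner_smul_right) 1 fun A B => by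
      simpa using abs_matInner_le A B) hφ (matInner_matGrad φ) (hg M) V W

theorem GradientLipschitz.norm_matHess_le {φ : Matrix (Fin n) (Fin n) ℝ → ℝ} {L : ℝ}
    (hφ : GradientLipschitz φ L) (hL : 0 ≤ L) (M V : Matrix (Fin n) (Fin n) ℝ) :
    ‖matHess φ M V‖ ≤ L * ‖V‖ := by
  refine ((fderiv ℝ (matGrad φ) M).le_opNorm V).trans ?_
  refine mul_le_mul_of_nonneg_right ?_ (norm_nonneg _)
  refine norm_fderiv_le_of_lip' ℝ hL (Filter.Eventually.of_forall fun N => ?_)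
  simpa using hφ.lipschitz M (N - M)

theorem hasDerivAt_matInner_matGrad {φ : Matrix (Fin n) (Fin n) ℝ → ℝ}
    (hg : Differentiable ℝ (matGrad φ)) (M E D : Matrix (Fin n) (Fin n) ℝ) (t : ℝ) :
    HasDerivAt (fun s : ℝ => matInner (matGrad φ (M + s • E)) D)
      (matInner (matHess φ (M + t • E) E) D) t := by
  let T : Matrix (Fin n) (Fin n) ℝ →L[ℝ] ℝ :=
    LinearMap.mkContinuous
      { toFun := fun A => matInner A D
        map_add' := fun A B => matInner_add_left A B D
        map_smul' := fun c A => matInner_smul_left c A D } ‖D‖ fun A => by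
          simpa [mul_comm] using abs_matInner_le A D
  have h1 : HasDerivAt (fun s : ℝ => M + s • E) E t := by
    have h := ((hasDerivAt_id t).smul_const E).const_add M
    rw [one_smul] at h
    exact h
  exact T.hasFDerivAt.comp_hasDerivAt t ((hg _).hasFDerivAt.comp_hasDerivAt t h1)

theorem hasDerivAt_along_line {φ : Matrix (Fin n) (Fin n) ℝ → ℝ} (hφ : Differentiable ℝ φ)
    (M E : Matrix (Fin n) (Fin n) ℝ) (t : ℝ) :
    HasDerivAt (fun s : ℝ => φ (M + s • E)) (matInner (matGrad φ (M + t • E)) E) t := by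
  have h1 : HasDerivAt (fun s : ℝ => M + s • E) E t := by
    have h := ((hasDerivAt_id t).smul_const E).const_add M
    rw [one_smul] at h
    exact h
  rw [matInner_matGrad]
  exact (hφ _).hasFDerivAt.comp_hasDerivAt t h1

theorem matGrad_eq_zero_of_isMinOn {φ : Matrix (Fin n) (Fin n) ℝ → ℝ}
    {M : Matrix (Fin n) (Fin n) ℝ} (h : IsMinOn φ Set.univ M) : matGrad φ M = 0 := by
  have h0 : fderiv ℝ φ M = 0 := (h.isLocalMin Filter.univ_mem).fderiv_eq_zero
  ext i j
  simp [matGrad, h0]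

/-- The mean value inequality replaces integration of the Hessian, which is not assumed continuous.
-/
theorem mul_le_sub_of_le_hasDerivAt {g g' : ℝ → ℝ} {c t : ℝ} (ht : 0 ≤ t)
    (hg : ∀ s, HasDerivAt g (g' s) s) (hc : ∀ s ∈ Set.Icc (0 : ℝ) t, c ≤ g' s) :
    c * t ≤ g t - g 0 := by
  have := (convex_Icc (0 : ℝ) t).mul_sub_le_image_sub_of_le_deriv
    (fun s _ => (hg s).continuousAt.continuousWithinAt)
    (fun s _ => (hg s).differentiableAt.differentiableWithinAt) (C := c)
    (fun s hs => by rw [(hg s).deriv]; exact hc s (interior_subset hs))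
    0 ⟨le_rfl, ht⟩ t ⟨ht, le_rfl⟩ ht
  simpa using this

/-- Quadratic growth along a line on which the Hessian is bounded below. -/
theorem quadratic_growth {φ : Matrix (Fin n) (Fin n) ℝ → ℝ} {c : ℝ} (hφ : Differentiable ℝ φ)
    (hg : Differentiable ℝ (matGrad φ)) {M E : Matrix (Fin n) (Fin n) ℝ} (hM : matGrad φ M = 0)
    (hc : ∀ t : ℝ, c ≤ matInner (matHess φ (M + t • E) E) E) :
    c / 2 ≤ φ (M + E) - φ M := by
  have h1 (t : ℝ) (ht : 0 ≤ t) : c * t ≤ matInner (matGrad φ (M + t • E)) E := by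
    have := mul_le_sub_of_le_hasDerivAt ht (hasDerivAt_matInner_matGrad hg M E E)
      (fun s _ => hc s)
    simpa [hM, matInner_zero_left] using this
  -- Applied to `φ(M + sE) - (c/2)s²`, nondecreasing on `[0, 1]` by `h1`.
  have h2 := mul_le_sub_of_le_hasDerivAt (c := 0) zero_le_one
    (fun s => (hasDerivAt_along_line hφ M E s).sub (((hasDerivAt_id s).pow 2).const_mul (c / 2)))
    (fun s hs => by simp; linarith [h1 s hs.1])
  simp at h2
  linarith

end Calculus

/-! ### Hessian bounds on low-rank matrices -/

section LowRank
variable {n r : ℕ} {φ : Matrix (Fin n) (Fin n) ℝ → ℝ} {μ L : ℝ}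

theorem rank_mul_add_mul_le (X Y : Matrix (Fin n) (Fin r) ℝ) (A B : Matrix (Fin r) (Fin n) ℝ) :
    (X * A + Y * B).rank ≤ 2 * r := by
  have h (X : Matrix (Fin n) (Fin r) ℝ) (A : Matrix (Fin r) (Fin n) ℝ) : (X * A).rank ≤ r :=
    (Matrix.rank_mul_le_left X A).trans (by simpa using X.rank_le_card_width)
  have hadd : (X * A + Y * B).rank ≤ (X * A).rank + (Y * B).rank := by
    rw [Matrix.rank, Matrix.mulVecLin_add]
    exact (Submodule.finrank_mono (LinearMap.range_add_le _ _)).trans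
      (Submodule.finrank_add_le_finrank_add_finrank _ _)
  linarith [h X A, h Y B]

theorem rank_line_le (X Y : Matrix (Fin n) (Fin r) ℝ) (t : ℝ) :
    (Y * Yᵀ + t • (X * Xᵀ - Y * Yᵀ)).rank ≤ 2 * r := by
  have h : Y * Yᵀ + t • (X * Xᵀ - Y * Yᵀ) = X * (t • Xᵀ) + Y * ((1 - t) • Yᵀ) := by
    rw [Matrix.mul_smul, Matrix.mul_smul]
    module
  rw [h]
  exact rank_mul_add_mul_le _ _ _ _

/-- A lower bound for the Hessian bilinear form by polarization, for `‖V‖ = ‖W‖`. -/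
theorem matHess_bilinear_lower_of_norm_eq (hL : 0 ≤ L) (hLip : GradientLipschitz φ L)
    (hRSC : RestrictedStronglyConvex φ μ (2 * r)) {M V W : Matrix (Fin n) (Fin n) ℝ}
    (hM : M.rank ≤ 2 * r) (hVW : (V + W).rank ≤ 2 * r) (hn : ‖W‖ = ‖V‖) :
    ((μ + L) * matInner V W - (L - μ) * ‖V‖ ^ 2) / 2 ≤ matInner (matHess φ M V) W := by
  have h1 := hRSC.strong M (V + W) hM hVW
  have h2 : matInner (matHess φ M (V - W)) (V - W) ≤ L * ‖V - W‖ ^ 2 := by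
    refine (matInner_le_norm_mul_norm _ _).trans ?_
    nlinarith [hLip.norm_matHess_le hL M (V - W), norm_nonneg (V - W)]
  have hs := matHess_symm hRSC.differentiable hRSC.differentiable_grad M V W
  have ha : matHess φ M (V + W) = matHess φ M V + matHess φ M W := map_add _ _ _
  have hb : matHess φ M (V - W) = matHess φ M V - matHess φ M W := map_sub _ _ _
  rw [norm_add_sq_matInner, ha, hn] at h1
  rw [norm_sub_sq_matInner, hb, hn] at h2
  simp only [matInner_add_left, matInner_add_right, matInner_sub_left, matInner_sub_right] at h1 h2
  linarith

/-- Rescaling `W` to the norm of `V` reduces to the previous case; this is why the rank bound is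
asked for every `c`. -/
theorem matHess_bilinear_lower (hL : 0 ≤ L) (hLip : GradientLipschitz φ L)
    (hRSC : RestrictedStronglyConvex φ μ (2 * r)) {M V W : Matrix (Fin n) (Fin n) ℝ}
    (hM : M.rank ≤ 2 * r) (hVW : ∀ c : ℝ, (V + c • W).rank ≤ 2 * r) (hV : V ≠ 0) (hW : W ≠ 0) :
    ((μ + L) * matInner V W - (L - μ) * (‖V‖ * ‖W‖)) / 2 ≤ matInner (matHess φ M V) W := by
  have hv : 0 < ‖V‖ := norm_pos_iff.mpr hV
  have hw : 0 < ‖W‖ := norm_pos_iff.mpr hW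
  have h := matHess_bilinear_lower_of_norm_eq hL hLip hRSC hM (hVW (‖V‖ / ‖W‖))
    (by rw [norm_smul, Real.norm_of_nonneg (by positivity), div_mul_cancel₀ _ hw.ne'])
  rw [matInner_smul_right, matInner_smul_right] at h
  have h2 := mul_le_mul_of_nonneg_left h (div_pos hw hv).le
  have e1 : ‖W‖ / ‖V‖ * (‖V‖ / ‖W‖ * matInner (matHess φ M V) W) = matInner (matHess φ M V) W := by
    field_simp
  have e2 : ‖W‖ / ‖V‖ * (((μ + L) * (‖V‖ / ‖W‖ * matInner V W) - (L - μ) * ‖V‖ ^ 2) / 2)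
      = ((μ + L) * matInner V W - (L - μ) * (‖V‖ * ‖W‖)) / 2 := by
    field_simp
  rwa [e1, e2] at h2

end LowRank

/-! ### The tangent component of the error -/

section Tangent
variable {n r : ℕ} {P E : Matrix (Fin n) (Fin n) ℝ}

/-- `E P - P E P / 2`, whose symmetrization is `E - (1 - P) E (1 - P)` for symmetric `E`. -/
noncomputable def halfTangent (P E : Matrix (Fin n) (Fin n) ℝ) : Matrix (Fin n) (Fin n) ℝ :=
  E * P - (1 / 2 : ℝ) • (P * E * P)

theorem halfTangent_mul (hP : P * P = P) : halfTangent P E * P = halfTangent P E := by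
  simp only [halfTangent, Matrix.sub_mul, Matrix.smul_mul, Matrix.mul_assoc, hP]

theorem mul_halfTangent (hP : P * P = P) : P * halfTangent P E = (1 / 2 : ℝ) • (P * E * P) := by
  rw [halfTangent, Matrix.mul_sub, Matrix.mul_smul]
  simp only [← Matrix.mul_assoc, hP]
  module

theorem halfTangent_transpose (hPt : Pᵀ = P) (hE : Eᵀ = E) :
    (halfTangent P E)ᵀ = P * E - (1 / 2 : ℝ) • (P * E * P) := by
  simp only [halfTangent, Matrix.transpose_sub, Matrix.transpose_smul, Matrix.transpose_mul, hPt, hE,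
    Matrix.mul_assoc]

theorem halfTangent_add_transpose (hPt : Pᵀ = P) (hE : Eᵀ = E) :
    halfTangent P E + (halfTangent P E)ᵀ = E - (1 - P) * E * (1 - P) := by
  rw [halfTangent_transpose hPt hE, halfTangent]
  have : (1 - P) * E * (1 - P) = E - P * E - E * P + P * E * P := by noncomm_ring
  rw [this]
  module

/-- With `Z = ZP` and `PZ` symmetric, the cross term `⟨Z, Zᵀ⟩` equals `‖PZ‖² ≥ 0`. -/
theorem two_mul_norm_halfTangent_sq_le (hPt : Pᵀ = P) (hP : P * P = P) (hE : Eᵀ = E) :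
    2 * ‖halfTangent P E‖ ^ 2 ≤ ‖halfTangent P E + (halfTangent P E)ᵀ‖ ^ 2 := by
  rw [norm_add_sq_matInner, norm_transpose_frobenius]
  have h : matInner (halfTangent P E) (halfTangent P E)ᵀ = ‖P * halfTangent P E‖ ^ 2 := by
    have hs : (P * halfTangent P E)ᵀ = P * halfTangent P E := by
      rw [mul_halfTangent hP, Matrix.transpose_smul, Matrix.transpose_mul, Matrix.transpose_mul,
        hPt, hE, Matrix.mul_assoc]
    have hs2 : (halfTangent P E)ᵀ * P = P * halfTangent P E := by
      rwa [Matrix.transpose_mul, hPt] at hs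
    rw [← matInner_self, matInner_transpose]
    nth_rewrite 2 [← halfTangent_mul hP]
    rw [matInner_mul_right, hPt, hs2]
    simp only [matInner, Matrix.transpose_mul, hPt, Matrix.mul_assoc]
    rw [← Matrix.mul_assoc P P, hP]
  rw [h]
  nlinarith [sq_nonneg ‖P * halfTangent P E‖]

/-- `Q` kills the correction `PEP/2`, so `QEP = QZ`. -/
theorem norm_compl_mul_mul_le_norm_halfTangent (hPt : Pᵀ = P) (hP : P * P = P) :
    ‖(1 - P) * E * P‖ ≤ ‖halfTangent P E‖ := by
  have hQt : (1 - P)ᵀ = 1 - P := by rw [Matrix.transpose_sub, Matrix.transpose_one, hPt]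
  have hQ : (1 - P) * (1 - P) = 1 - P := by
    simp [Matrix.mul_sub, Matrix.sub_mul, hP]
  have h : (1 - P) * E * P = (1 - P) * halfTangent P E := by
    rw [Matrix.sub_mul 1 P (halfTangent P E), mul_halfTangent hP, Matrix.one_mul, halfTangent]
    have : (1 - P) * E * P = E * P - P * E * P := by noncomm_ring
    rw [this]
    module
  rw [h, ← norm_transpose_frobenius, ← norm_transpose_frobenius (halfTangent P E),
    Matrix.transpose_mul, hQt]
  exact norm_mul_projection_le hQt hQ _

theorem matInner_tangent_normal (hPt : Pᵀ = P) (hP : P * P = P) (hE : Eᵀ = E) :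
    matInner (halfTangent P E + (halfTangent P E)ᵀ) ((1 - P) * E * (1 - P)) = 0 := by
  have hQt : (1 - P)ᵀ = 1 - P := by rw [Matrix.transpose_sub, Matrix.transpose_one, hPt]
  have hPQ : P * (1 - P) = 0 := by rw [Matrix.mul_sub, Matrix.mul_one, hP, sub_self]
  have h1 : matInner (halfTangent P E) ((1 - P) * E * (1 - P)) = 0 := by
    rw [matInner_mul_right, hQt, ← halfTangent_mul hP, Matrix.mul_assoc, hPQ, Matrix.mul_zero,
      matInner_zero_left]
  have h2 : ((1 - P) * E * (1 - P))ᵀ = (1 - P) * E * (1 - P) := by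
    simp only [Matrix.transpose_mul, hQt, hE, Matrix.mul_assoc]
  rw [matInner_add_left, h1, zero_add, ← h2, matInner_transpose, Matrix.transpose_transpose, h1]

theorem matInner_add_transpose_halfTangent (hPt : Pᵀ = P) (hP : P * P = P)
    (G : Matrix (Fin n) (Fin n) ℝ) :
    matInner G (halfTangent P E + (halfTangent P E)ᵀ)
      = matInner ((G + Gᵀ) * P) (halfTangent P E) := by
  rw [matInner_add_right, matInner_transpose, ← matInner_add_left]
  nth_rewrite 1 [← halfTangent_mul hP]
  rw [matInner_mul_right, hPt]

end Tangent

/-- The normal component of the error is small once the error is below the spectral gap of `Y Yᵀ`. -/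
theorem norm_normal_mul_eigDesc_le {n r : ℕ} (X Y : Matrix (Fin n) (Fin r) ℝ)
    {P : Matrix (Fin n) (Fin n) ℝ} (hPt : Pᵀ = P) (hP : P * P = P) (hPX : P * X = X) :
    eigDesc (Y * Yᵀ) (Y * Yᵀ).rank * ‖(1 - P) * (X * Xᵀ - Y * Yᵀ) * (1 - P)‖
        ≤ ‖X * Xᵀ - Y * Yᵀ‖ ^ 2 ∧
      ‖X * Xᵀ - Y * Yᵀ‖ ^ 2 = ‖halfTangent P (X * Xᵀ - Y * Yᵀ)
        + (halfTangent P (X * Xᵀ - Y * Yᵀ))ᵀ‖ ^ 2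
        + ‖(1 - P) * (X * Xᵀ - Y * Yᵀ) * (1 - P)‖ ^ 2 := by
  have hE : (X * Xᵀ - Y * Yᵀ)ᵀ = X * Xᵀ - Y * Yᵀ := by
    simp [Matrix.transpose_sub, Matrix.transpose_mul]
  have hQt : (1 - P)ᵀ = 1 - P := by rw [Matrix.transpose_sub, Matrix.transpose_one, hPt]
  have hQE : (1 - P) * (X * Xᵀ - Y * Yᵀ) = -((1 - P) * (Y * Yᵀ)) := by
    rw [Matrix.mul_sub, ← Matrix.mul_assoc (1 - P) X, Matrix.sub_mul 1 P X, hPX, Matrix.one_mul,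
      sub_self, Matrix.zero_mul, zero_sub]
  have h1 := eigDesc_mul_norm_compression_le Y hQt
  have h2 := norm_sq_eq_add_of_projection hPt hP ((1 - P) * (Y * Yᵀ))
  have h3 := norm_compl_mul_mul_le_norm_halfTangent (E := X * Xᵀ - Y * Yᵀ) hPt hP
  have h4 := two_mul_norm_halfTangent_sq_le hPt hP hE
  have h5 : ‖X * Xᵀ - Y * Yᵀ‖ ^ 2 = ‖halfTangent P (X * Xᵀ - Y * Yᵀ)
        + (halfTangent P (X * Xᵀ - Y * Yᵀ))ᵀ‖ ^ 2
        + ‖(1 - P) * (X * Xᵀ - Y * Yᵀ) * (1 - P)‖ ^ 2 := by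
    have h6 := matInner_tangent_normal hPt hP hE
    have h7 := halfTangent_add_transpose hPt hE
    have h8 := norm_add_sq_matInner (halfTangent P (X * Xᵀ - Y * Yᵀ)
        + (halfTangent P (X * Xᵀ - Y * Yᵀ))ᵀ) ((1 - P) * (X * Xᵀ - Y * Yᵀ) * (1 - P))
    rw [h6, mul_zero, add_zero] at h8
    rw [← h8, h7, sub_add_cancel]
  refine ⟨?_, h5⟩
  -- With `M = YYᵀ`, split `‖QM‖² = ‖QMP‖² + ‖QMQ‖²`; the first term is at most `‖Z‖² ≤ ‖D‖²`, and
  -- Pythagoras sums the two bounds to `‖E‖²`.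
  rw [hQE, Matrix.neg_mul, norm_neg] at h3 h5 ⊢
  have h9 := pow_le_pow_left₀ (norm_nonneg _) h3 2
  nlinarith [sq_nonneg ‖(1 - P) * (Y * Yᵀ) * P‖]

/-- The numerical core: `c` is the norm of the normal part and `d` that of the tangent part. -/
theorem tangent_bound {μ L lam e c d : ℝ} (hμ : 0 < μ) (hL : 0 < L) (he : 0 < e) (hc : 0 ≤ c)
    (hd : 0 ≤ d) (hlam : 0 ≤ lam) (hpyth : e ^ 2 = d ^ 2 + c ^ 2) (hgap : lam * c ≤ e ^ 2)
    (hsmall : (μ + L) * e ^ 2 ≤ μ * lam ^ 2) : L * e ≤ (μ + L) * d := by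
  have h1 : (μ + L) * c ^ 2 ≤ μ * e ^ 2 := by
    have h2 : (μ + L) * e ^ 2 * c ^ 2 ≤ μ * e ^ 2 * e ^ 2 := by
      calc (μ + L) * e ^ 2 * c ^ 2 ≤ μ * lam ^ 2 * c ^ 2 := by gcongr
        _ = μ * (lam * c) ^ 2 := by ring
        _ ≤ μ * (e ^ 2) ^ 2 := by gcongr
        _ = μ * e ^ 2 * e ^ 2 := by ring
    have he2 : 0 < e ^ 2 := by positivity
    nlinarith
  have h3 : L * e ^ 2 ≤ (μ + L) * d ^ 2 := by nlinarith
  refine le_of_sq_le_sq ?_ (by positivity)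
  -- Enlarging one factor `L` to `μ + L` trades the ratio `√(L/(μ + L))` for the weaker `L/(μ + L)`,
  -- which suffices.
  calc (L * e) ^ 2 = L * (L * e ^ 2) := by ring
    _ ≤ (μ + L) * ((μ + L) * d ^ 2) := by gcongr; linarith
    _ = ((μ + L) * d) ^ 2 := by ring

theorem norm_factored_gradient_lower {n r : ℕ} {φ : Matrix (Fin n) (Fin n) ℝ → ℝ} {μ L : ℝ}
    (hμ : 0 < μ) (hL : 0 < L) (hLip : GradientLipschitz φ L)
    (hRSC : RestrictedStronglyConvex φ μ (2 * r)) (X Y : Matrix (Fin n) (Fin r) ℝ)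
    (hmin : IsMinOn φ Set.univ (Y * Yᵀ))
    (hX : φ (X * Xᵀ) - φ (Y * Yᵀ)
      ≤ μ / (2 * (1 + L / μ)) * eigDesc (Y * Yᵀ) (Y * Yᵀ).rank ^ 2) :
    μ / √2 * ‖X * Xᵀ - Y * Yᵀ‖
      ≤ ‖(matGrad φ (X * Xᵀ) + (matGrad φ (X * Xᵀ))ᵀ) * colProj X‖ := by
  have hPt := colProj_transpose X
  have hP := colProj_mul_self X
  obtain ⟨hgap, hpyth⟩ := norm_normal_mul_eigDesc_le X Y hPt hP (colProj_mul X)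
  have hE : (X * Xᵀ - Y * Yᵀ)ᵀ = X * Xᵀ - Y * Yᵀ := by
    simp [Matrix.transpose_sub, Matrix.transpose_mul]
  have hlow := two_mul_norm_halfTangent_sq_le hPt hP hE
  have htan := halfTangent_add_transpose hPt hE
  have hPE := colProj_eq X
  have horth := matInner_tangent_normal hPt hP hE
  have hinner := matInner_add_transpose_halfTangent (E := X * Xᵀ - Y * Yᵀ) hPt hP
    (matGrad φ (X * Xᵀ))
  have htr := halfTangent_transpose hPt hE
  have hline := rank_line_le X Y
  have hgrad0 := matGrad_eq_zero_of_isMinOn hmin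
  have hend : Y * Yᵀ + (X * Xᵀ - Y * Yᵀ) = X * Xᵀ := add_sub_cancel _ _
  -- As `D = EP + PE - PEP`, all columns of `E + cD` lie in the span of those of `X` and `Y`. The
  -- case `c = 0` covers `E` itself.
  have hspan (c : ℝ) : ((X * Xᵀ - Y * Yᵀ) + c • (halfTangent (colProj X) (X * Xᵀ - Y * Yᵀ)
      + (halfTangent (colProj X) (X * Xᵀ - Y * Yᵀ))ᵀ)).rank ≤ 2 * r := by
    rw [htr, halfTangent]
    obtain ⟨Q, hQ⟩ : ∃ Q, colProj X = X * Q := ⟨_, hPE⟩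
    have : (X * Xᵀ - Y * Yᵀ) + c • ((X * Xᵀ - Y * Yᵀ) * colProj X
        - (1 / 2 : ℝ) • (colProj X * (X * Xᵀ - Y * Yᵀ) * colProj X)
        + (colProj X * (X * Xᵀ - Y * Yᵀ)
        - (1 / 2 : ℝ) • (colProj X * (X * Xᵀ - Y * Yᵀ) * colProj X)))
        = X * (Xᵀ + c • (Xᵀ * colProj X + Q * (X * Xᵀ - Y * Yᵀ)
          - Q * (X * Xᵀ - Y * Yᵀ) * colProj X))
          + Y * (- Yᵀ - c • (Yᵀ * colProj X)) := by
      have e1 : colProj X * (X * Xᵀ - Y * Yᵀ) = X * (Q * (X * Xᵀ - Y * Yᵀ)) := by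
        rw [hQ, Matrix.mul_assoc]
      have e2 : (X * Xᵀ - Y * Yᵀ) * colProj X = X * (Xᵀ * colProj X) - Y * (Yᵀ * colProj X) := by
        rw [Matrix.sub_mul, Matrix.mul_assoc, Matrix.mul_assoc]
      rw [e1, e2, Matrix.mul_assoc X (Q * (X * Xᵀ - Y * Yᵀ)) (colProj X)]
      simp only [Matrix.mul_add X, Matrix.mul_sub Y, Matrix.mul_smul, Matrix.mul_neg,
        Matrix.mul_sub X (Xᵀ * colProj X + Q * (X * Xᵀ - Y * Yᵀ))]
      module
    rw [this]
    exact rank_mul_add_mul_le _ _ _ _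
  set lam := eigDesc (Y * Yᵀ) (Y * Yᵀ).rank with hlam
  set E := X * Xᵀ - Y * Yᵀ with hEdef
  set Z := halfTangent (colProj X) E with hZ
  set C := (1 - colProj X) * E * (1 - colProj X) with hC
  set D := Z + Zᵀ with hD
  rcases (norm_nonneg E).eq_or_lt with he | he
  · rw [← he, mul_zero]
    exact norm_nonneg _
  have hgrowth : μ * ‖E‖ ^ 2 / 2 ≤ φ (X * Xᵀ) - φ (Y * Yᵀ) := by
    have := quadratic_growth (c := μ * ‖E‖ ^ 2) hRSC.differentiable hRSC.differentiable_grad hgrad0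
      (E := E) fun t => hRSC.strong _ E (hline t) (by simpa using hspan 0)
    rwa [hend] at this
  -- The threshold in the hypothesis equals `μ²λ²/(2(μ + L))`; one factor `μ/2` cancels against
  -- quadratic growth.
  have hsmall : (μ + L) * ‖E‖ ^ 2 ≤ μ * lam ^ 2 := by
    have h1 := hgrowth.trans hX
    have h2 : μ / (2 * (1 + L / μ)) = μ * μ / (2 * (μ + L)) := by field_simp
    rw [h2, div_mul_eq_mul_div, div_le_div_iff₀ two_pos (by positivity)] at h1
    nlinarith
  have hkey : L * ‖E‖ ≤ (μ + L) * ‖D‖ :=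
    tangent_bound hμ hL he (norm_nonneg C) (norm_nonneg D)
      (eigDesc_rank_nonneg (posSemidef_mul_transpose_self Y)) hpyth hgap hsmall
  have hd : 0 < ‖D‖ := by
    have : 0 < (μ + L) * ‖D‖ := lt_of_lt_of_le (by positivity) hkey
    exact pos_of_mul_pos_right this (by positivity)
  have hED : matInner E D = ‖D‖ ^ 2 := by
    have : E = D + C := by rw [htan, sub_add_cancel]
    rw [this, matInner_add_left, matInner_self, matInner_comm, horth, add_zero]
  -- `hkey` replaces `(μ + L)‖D‖²` by `L‖E‖‖D‖`, so subtracting `(L - μ)‖E‖‖D‖` leaves exactly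
  -- `μ‖E‖‖D‖`.
  have hmain : μ / 2 * ‖E‖ * ‖D‖ ≤ matInner (matGrad φ (X * Xᵀ)) D := by
    have h1 := mul_le_sub_of_le_hasDerivAt zero_le_one
      (hasDerivAt_matInner_matGrad hRSC.differentiable_grad (Y * Yᵀ) E D)
      (fun t _ => matHess_bilinear_lower hL.le hLip hRSC (hline t) hspan (norm_pos_iff.mp he)
        (norm_pos_iff.mp hd))
    rw [one_smul, zero_smul, add_zero, hend, hgrad0, matInner_zero_left, hED] at h1
    nlinarith [mul_le_mul_of_nonneg_right hkey hd.le]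
  have hZD : √2 * ‖Z‖ ≤ ‖D‖ := by
    refine le_of_sq_le_sq ?_ (norm_nonneg _)
    rwa [mul_pow, Real.sq_sqrt zero_le_two]
  rw [hinner] at hmain
  have h2 := hmain.trans (matInner_le_norm_mul_norm _ _)
  set K := ‖(matGrad φ (X * Xᵀ) + (matGrad φ (X * Xᵀ))ᵀ) * colProj X‖
  have hs : 0 < √(2 : ℝ) := by positivity
  have hss : √(2 : ℝ) * √2 = 2 := Real.mul_self_sqrt zero_le_two
  have h3 : √2 * (μ / 2 * ‖E‖) * ‖D‖ ≤ K * ‖D‖ := by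
    calc √2 * (μ / 2 * ‖E‖) * ‖D‖ = √2 * (μ / 2 * ‖E‖ * ‖D‖) := by ring
      _ ≤ √2 * (K * ‖Z‖) := by gcongr
      _ = K * (√2 * ‖Z‖) := by ring
      _ ≤ K * ‖D‖ := by gcongr
  have h4 := le_of_mul_le_mul_right h3 hd
  calc μ / √2 * ‖E‖ = √2 * (μ / 2 * ‖E‖) := by
        rw [div_mul_eq_mul_div, div_eq_iff hs.ne']
        linear_combination (-(μ / 2 * ‖E‖)) * hss
    _ ≤ K := h4

theorem norm_factored_gradient_upper {n r : ℕ} {φ : Matrix (Fin n) (Fin n) ℝ → ℝ} {L : ℝ}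
    (hLip : GradientLipschitz φ L) (X : Matrix (Fin n) (Fin r) ℝ) {M : Matrix (Fin n) (Fin n) ℝ}
    (hmin : IsMinOn φ Set.univ M) :
    ‖(matGrad φ (X * Xᵀ) + (matGrad φ (X * Xᵀ))ᵀ) * colProj X‖ ≤ 2 * L * ‖X * Xᵀ - M‖ := by
  have h := hLip.lipschitz M (X * Xᵀ - M)
  rw [matGrad_eq_zero_of_isMinOn hmin, sub_zero, add_sub_cancel] at h
  calc _ ≤ ‖matGrad φ (X * Xᵀ) + (matGrad φ (X * Xᵀ))ᵀ‖ :=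
        norm_mul_projection_le (colProj_transpose X) (colProj_mul_self X) _
    _ ≤ ‖matGrad φ (X * Xᵀ)‖ + ‖(matGrad φ (X * Xᵀ))ᵀ‖ := norm_add_le _ _
    _ ≤ 2 * L * ‖X * Xᵀ - M‖ := by rw [norm_transpose_frobenius]; linarith

theorem mainTheorem6 {n r : ℕ} (φ : Matrix (Fin n) (Fin n) ℝ → ℝ) (μ L₁ : ℝ)
    (hμ : 0 < μ) (hL : 0 < L₁)
    (hLip : GradientLipschitz φ L₁)
    (hRSC : RestrictedStronglyConvex φ μ (2 * r))
    (Mstar : Matrix (Fin n) (Fin n) ℝ) (Xstar : Matrix (Fin n) (Fin r) ℝ)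
    (hmin : IsMinOn φ Set.univ Mstar)
    (hfac : Mstar = Xstar * Xstarᵀ)
    (X : Matrix (Fin n) (Fin r) ℝ)
    (hX : factored r φ X - factored r φ Xstar
      ≤ μ / (2 * (1 + L₁ / μ)) * eigDesc Mstar Mstar.rank ^ 2) :
    (μ / √2 * ‖X * Xᵀ - Mstar‖ ≤ ‖matGrad (factored r φ) X * invSqrt (Xᵀ * X)‖ ∧
      ‖matGrad (factored r φ) X * invSqrt (Xᵀ * X)‖ ≤ 2 * L₁ * ‖X * Xᵀ - Mstar‖) ∧
    AdmissibleEta Mstar X (μ / √2) (2 * L₁) (optimalEta φ X) := by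
  subst hfac
  have heq : ‖matGrad (factored r φ) X * invSqrt (Xᵀ * X)‖
      = ‖(matGrad φ (X * Xᵀ) + (matGrad φ (X * Xᵀ))ᵀ) * colProj X‖ := by
    rw [matGrad_factored hLip.differentiable, norm_mul_mul_invSqrt]
  have hlow := norm_factored_gradient_lower hμ hL hLip hRSC X Xstar hmin hX
  have hup := norm_factored_gradient_upper hLip X hmin
  rw [← heq] at hlow hup
  exact ⟨⟨hlow, hup⟩, by positivity, by positivity, norm_nonneg _, hlow, hup⟩
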